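/- **Theorem 1.2.** The exponential map $f\colon\mathbb{C}\to\mathbb{C}$, $f(z)=e^z$, is chaotic in the sense of Devaney. Here a continuous map $f\colon X\to X$ of an infinite topological space $X$ (for instance, an infinite subset of the plane) is called chaotic in the sense of Devaney if 1. the set of periodic points of $f$, that is, of all $x\in X$ such that $f^n(x)=x$ for some $n\ge 1$, is dense in $X$; and 2. $f$ is topologically transitive: for all nonempty open sets $U,V\subset X$ there are a point $z\in U$ and an integer $n\ge 0$ such that $f^n(z)\in V$, where $f^n$ denotes the $n$-th iterate of $f$ (and $f^0$ is the identity). -/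

import Mathlib

/-- A self-map `f` of a space `X` is topologically transitive if any nonempty open set `U` contains
a point some iterate `f^n`, `n ≥ 0`, of which lies in any prescribed nonempty open set `V`. -/
def IsTopTransitive {X : Type*} [TopologicalSpace X] (f : X → X) : Prop :=
  ∀ U V : Set X, IsOpen U → IsOpen V → U.Nonempty → V.Nonempty →
    ∃ z ∈ U, ∃ n : ℕ, f^[n] z ∈ V

/-- Chaos in the sense of Devaney: a continuous self-map of an infinite space whose periodic points
are dense and which is topologically transitive. (`Function.periodicPts f` is the set of `x` with
`f^[n] x = x` for some `n ≥ 1`.) A subset of the plane enters as its subtype. -/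
structure IsDevaneyChaotic {X : Type*} [TopologicalSpace X] (f : X → X) : Prop where
  infinite : Infinite X
  continuous : Continuous f
  dense_periodicPts : Dense (Function.periodicPts f)
  transitive : IsTopTransitive f

/-! Both properties follow from one fact (`exists_ball_half_norm`): for `v ≠ 0`, every nonempty open
`U` contains the image of the disc of radius `‖v‖ / 2` about `v` under an inverse branch of some
iterate. Transitivity is immediate; taking for `U` a small disc about `v` makes the branch a
contraction, whose fixed point is periodic. To get the branch, some orbit from `U` must reach the
real line: otherwise the Schwarz lemma bounds `(f^n)'` by the imaginary part, which forces `(f^n)' →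
0` and orbits close to the real axis, where `exp` does not contract. On the real line orbits tend to
infinity and discs grow; two more exponentials cover a disc about any `v ≠ 0`. -/

open Set Metric Filter Topology Function

/-! ### Iterated preimages of the real line under the exponential map -/

/-- The Schwarz lemma for maps from a disc into the upper or the lower half-plane. -/
theorem norm_deriv_le_of_im_ne_zero {h : ℂ → ℂ} {a : ℂ} {r : ℝ} (hr : 0 < r)
    (hd : DifferentiableOn ℂ h (ball a r)) (him : ∀ z ∈ ball a r, (h z).im ≠ 0) :
    ‖deriv h a‖ ≤ 2 / r * |(h a).im| := by
  have ha : a ∈ ball a r := mem_ball_self hr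
  have hsign : ∀ z ∈ ball a r, 0 < (h z).im * (h a).im := by
    intro z hz
    by_contra! hneg
    have hpre : IsPreconnected ((fun z => (h z).im * (h a).im) '' ball a r) :=
      (convex_ball a r).isPreconnected.image _
        ((Complex.continuous_im.comp_continuousOn hd.continuousOn).mul continuousOn_const)
    have hpos : (0 : ℝ) ≤ (h a).im * (h a).im := mul_self_nonneg _
    obtain ⟨w, hw, hw0⟩ := hpre.ordConnected.out ⟨z, hz, rfl⟩ ⟨a, ha, rfl⟩ ⟨hneg, hpos⟩
    exact mul_ne_zero (him w hw) (him a ha) hw0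
  set w : ℂ := h a with hw
  have hden : ∀ z ∈ ball a r, h z - (starRingEnd ℂ) w ≠ 0 := by
    intro z hz h0
    have h1 := congrArg Complex.im h0
    simp only [Complex.sub_im, Complex.conj_im, Complex.zero_im] at h1
    have h2 := hsign z hz
    have h3 : (h z).im = - w.im := by linarith
    rw [h3] at h2
    nlinarith [mul_self_nonneg w.im]
  set φ : ℂ → ℂ := fun z => (h z - w) / (h z - (starRingEnd ℂ) w) with hφ
  have hφd : DifferentiableOn ℂ φ (ball a r) := (hd.sub_const _).div (hd.sub_const _) hden
  have hφa : φ a = 0 := by simp [hφ, hw]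
  have hmaps : MapsTo φ (ball a r) (closedBall (φ a) 1) := by
    intro z hz
    rw [hφa, mem_closedBall_zero_iff, hφ]
    simp only [norm_div]
    apply div_le_one_of_le₀ _ (norm_nonneg _)
    rw [← sq_le_sq₀ (norm_nonneg _) (norm_nonneg _), Complex.sq_norm, Complex.sq_norm,
      Complex.normSq_apply, Complex.normSq_apply]
    simp only [Complex.sub_re, Complex.sub_im, Complex.conj_re, Complex.conj_im]
    nlinarith [hsign z hz]
  have hle := Complex.norm_deriv_le_div_of_mapsTo_ball hφd hmaps hr
  have hha : HasDerivAt h (deriv h a) a :=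
    (hd.differentiableAt (ball_mem_nhds a hr)).hasDerivAt
  have hφ' : HasDerivAt φ (deriv h a / (w - (starRingEnd ℂ) w)) a := by
    have h0 : w - (starRingEnd ℂ) w ≠ 0 := hden a ha
    have h1 := (hha.sub_const w).div (hha.sub_const ((starRingEnd ℂ) w)) (hden a ha)
    have h2 : (deriv h a * (h a - (starRingEnd ℂ) w) - (h a - w) * deriv h a) /
        (h a - (starRingEnd ℂ) w) ^ 2 = deriv h a / (w - (starRingEnd ℂ) w) := by
      rw [← hw]
      field_simp
      ring
    exact h2 ▸ h1
  rw [hφ'.deriv, norm_div, Complex.sub_conj] at hle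
  have h4 : ‖((2 * w.im : ℝ) : ℂ) * Complex.I‖ = 2 * |w.im| := by
    simp
  have him0 : 0 < |w.im| := abs_pos.2 (him a ha)
  rw [h4, div_le_iff₀ (by positivity)] at hle
  calc ‖deriv h a‖ ≤ 1 / r * (2 * |w.im|) := hle
    _ = 2 / r * |w.im| := by ring

theorem hasDerivAt_iterate_exp (n : ℕ) (a : ℂ) :
    HasDerivAt (Complex.exp^[n]) (∏ j ∈ Finset.range n, Complex.exp^[j + 1] a) a := by
  induction n with
  | zero => simpa using hasDerivAt_id a
  | succ n ih =>
    rw [iterate_succ', Finset.prod_range_succ, mul_comm, iterate_succ_apply']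
    exact (Complex.hasDerivAt_exp _).comp a ih

theorem norm_iterate_exp_succ (n : ℕ) (a : ℂ) :
    ‖Complex.exp^[n + 1] a‖ = Real.exp (Complex.exp^[n] a).re := by
  rw [iterate_succ_apply', Complex.norm_exp]

theorem abs_im_iterate_exp_succ (n : ℕ) (a : ℂ) :
    |(Complex.exp^[n + 1] a).im|
      = ‖Complex.exp^[n + 1] a‖ * |Real.sin (Complex.exp^[n] a).im| := by
  rw [norm_iterate_exp_succ, iterate_succ_apply', Complex.exp_im, abs_mul, Real.abs_exp]

/-- A bounded real sequence along which `|y| - |sin y|` tends to zero tends to zero. -/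
theorem tendsto_zero_of_abs_sub_abs_sin {y : ℕ → ℝ} {B : ℝ} (hB : ∀ n, |y n| ≤ B)
    (h : Tendsto (fun n => |y n| - |Real.sin (y n)|) atTop (𝓝 0)) :
    Tendsto y atTop (𝓝 0) := by
  refine (isCompact_closedBall (0 : ℝ) B).tendsto_nhds_of_unique_mapClusterPt
    (Eventually.of_forall fun n => by simpa using hB n) ?_
  intro x _ hx
  have hc : Continuous fun t : ℝ => |t| - |Real.sin t| := by fun_prop
  have h1 : MapClusterPt (|x| - |Real.sin x|) atTop (fun n => |y n| - |Real.sin (y n)|) :=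
    hx.continuousAt_comp hc.continuousAt
  have h2 : |x| - |Real.sin x| = 0 :=
    haveI : NeBot (𝓝 (|x| - |Real.sin x|) ⊓ 𝓝 (0 : ℝ)) := ClusterPt.mono h1 h
    eq_of_nhds_neBot this
  by_contra hx0
  linarith [Real.abs_sin_lt_abs hx0]

/-- The points that some iterate of the exponential map sends to the real line are dense. -/
theorem exists_iterate_exp_im_eq_zero {U : Set ℂ} (hU : IsOpen U) (hne : U.Nonempty) :
    ∃ z ∈ U, ∃ n : ℕ, (Complex.exp^[n] z).im = 0 := by
  by_contra! hcon
  obtain ⟨a, ha⟩ := hne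
  obtain ⟨r, hr, hrU⟩ := Metric.isOpen_iff.1 hU a ha
  set y : ℕ → ℝ := fun n => (Complex.exp^[n] a).im with hy
  set M : ℕ → ℝ := fun n => ∏ j ∈ Finset.range n, ‖Complex.exp^[j + 1] a‖ with hM
  set C : ℝ := 2 / r with hC
  have hCpos : 0 < C := by positivity
  have hMsucc : ∀ n, M (n + 1) = M n * ‖Complex.exp^[n + 1] a‖ := fun n =>
    Finset.prod_range_succ _ n
  have hzpos : ∀ n, 0 < ‖Complex.exp^[n + 1] a‖ := fun n => by
    rw [norm_iterate_exp_succ]; exact Real.exp_pos _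
  have hMpos : ∀ n, 0 < M n := fun n => Finset.prod_pos fun j _ => hzpos j
  have hMy : ∀ n, M n ≤ C * |y n| := by
    intro n
    have h1 := norm_deriv_le_of_im_ne_zero (h := Complex.exp^[n]) hr
      (fun z _ => (hasDerivAt_iterate_exp n z).differentiableAt.differentiableWithinAt)
      (fun z hz => hcon z (hrU hz) n)
    rwa [(hasDerivAt_iterate_exp n a).deriv, norm_prod] at h1
  have hysucc : ∀ n, |y (n + 1)| = ‖Complex.exp^[n + 1] a‖ * |Real.sin (y n)| := fun n =>
    abs_im_iterate_exp_succ n a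
  -- The bound `hMy` at index `n + 1` has the factor `‖Complex.exp^[n + 1] a‖` on both sides; cancel
  -- it.
  have hMC : ∀ n, M n ≤ C := by
    intro n
    have h1 := hMy (n + 1)
    rw [hMsucc, hysucc] at h1
    have h2 : C * (‖Complex.exp^[n + 1] a‖ * |Real.sin (y n)|) ≤ C * ‖Complex.exp^[n + 1] a‖ := by
      have := Real.abs_sin_le_one (y n)
      gcongr
      exact mul_le_of_le_one_right (hzpos n).le this
    exact le_of_mul_le_mul_right (h1.trans h2) (hzpos n)
  -- The same cancellation gives `q (n + 1) = |sin (y n)| / M n`, so `q` decreases and its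
  -- convergence forces `|y n| - |sin (y n)| → 0`.
  set q : ℕ → ℝ := fun n => |y n| / M n with hq
  have hdiff : ∀ n, |y n| - |Real.sin (y n)| = M n * (q n - q (n + 1)) := by
    intro n
    have h1 := (hMpos n).ne'
    have h2 := (hzpos n).ne'
    simp only [hq]
    rw [hMsucc, hysucc]
    field_simp
  have hqanti : Antitone q := antitone_nat_of_succ_le fun n => by
    have h1 := hdiff n
    have h2 : 0 ≤ |y n| - |Real.sin (y n)| := sub_nonneg.2 Real.abs_sin_le_abs
    rw [h1] at h2
    linarith [nonneg_of_mul_nonneg_right h2 (hMpos n)]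
  have hqnn : ∀ n, 0 ≤ q n := fun n => div_nonneg (abs_nonneg _) (hMpos n).le
  have hqlim := tendsto_atTop_ciInf hqanti ⟨0, by rintro _ ⟨n, rfl⟩; exact hqnn n⟩
  have hqd : Tendsto (fun n => C * (q n - q (n + 1))) atTop (𝓝 0) := by
    simpa using (hqlim.sub (hqlim.comp (tendsto_add_atTop_nat 1))).const_mul C
  have hB : ∀ n, |y n| ≤ q 0 * C := by
    intro n
    have h1 : |y n| = q n * M n := by
      simp only [hq]
      rw [div_mul_cancel₀ _ (hMpos n).ne']
    rw [h1]
    exact mul_le_mul (hqanti (Nat.zero_le n)) (hMC n) (hMpos n).le (hqnn 0)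
  have hy0 : Tendsto y atTop (𝓝 0) := by
    refine tendsto_zero_of_abs_sub_abs_sin hB
      (squeeze_zero (fun n => sub_nonneg.2 Real.abs_sin_le_abs) (fun n => ?_) hqd)
    rw [hdiff]
    exact mul_le_mul_of_nonneg_right (hMC n) (sub_nonneg.2 (hqanti n.le_succ))
  have hM0 : Tendsto M atTop (𝓝 0) := by
    refine squeeze_zero (fun n => (hMpos n).le) hMy ?_
    simpa using hy0.abs.const_mul C
  have hcos : ∀ᶠ n in atTop, 0 < Real.cos (y n) := by
    have h1 : Tendsto (fun n => Real.cos (y n)) atTop (𝓝 1) := by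
      simpa [comp_def] using (Real.continuous_cos.tendsto 0).comp hy0
    exact h1.eventually (lt_mem_nhds one_pos)
  obtain ⟨N, hN⟩ := eventually_atTop.1 hcos
  -- A positive cosine puts the next iterate in the right half-plane, so the factor after it has
  -- modulus at least 1; this contradicts `M → 0`.
  have hmono : ∀ n ≥ N + 1, M n ≤ M (n + 1) := by
    intro n hn
    obtain ⟨k, rfl⟩ : ∃ k, n = k + 1 := ⟨n - 1, by omega⟩
    rw [hMsucc (k + 1)]
    refine le_mul_of_one_le_right (hMpos _).le ?_
    rw [norm_iterate_exp_succ, iterate_succ_apply', Complex.exp_re]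
    exact Real.one_le_exp (mul_pos (Real.exp_pos _) (hN k (by omega))).le
  have hge : ∀ n ≥ N + 1, M (N + 1) ≤ M n := fun n hn =>
    Nat.le_induction le_rfl (fun k hk ih => ih.trans (hmono k hk)) n hn
  have := ge_of_tendsto hM0 (eventually_atTop.2 ⟨N + 1, hge⟩)
  linarith [hMpos (N + 1)]

/-! ### Inverse branches of iterates of the exponential map -/

/-- The `n`-th iterate of the exponential map has a holomorphic right inverse on `B` with values
in `A`. -/
def HasInverseBranch (n : ℕ) (A B : Set ℂ) : Prop :=
  ∃ g : ℂ → ℂ, DifferentiableOn ℂ g B ∧ MapsTo g B A ∧ ∀ w ∈ B, Complex.exp^[n] (g w) = w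

namespace HasInverseBranch

theorem refl (A : Set ℂ) : HasInverseBranch 0 A A :=
  ⟨id, differentiableOn_id, mapsTo_id A, fun _ _ => rfl⟩

theorem mono {n : ℕ} {A A' B B' : Set ℂ} (h : HasInverseBranch n A B) (hA : A ⊆ A')
    (hB : B' ⊆ B) : HasInverseBranch n A' B' := by
  obtain ⟨g, hd, hm, he⟩ := h
  exact ⟨g, hd.mono hB, (hm.mono_left hB).mono_right hA, fun w hw => he w (hB hw)⟩

theorem trans {m n : ℕ} {A B B' D : Set ℂ} (h : HasInverseBranch m A B)
    (h' : HasInverseBranch n B' D) (hB : B' ⊆ B) : HasInverseBranch (n + m) A D := by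
  obtain ⟨g, hd, hm, he⟩ := h.mono Subset.rfl hB
  obtain ⟨g', hd', hm', he'⟩ := h'
  refine ⟨g ∘ g', hd.comp hd' hm', hm.comp hm', fun w hw => ?_⟩
  rw [comp_apply, iterate_add_apply, he _ (hm' hw), he' w hw]

/-- The branch is a translated principal logarithm; `‖log (1 + u)‖ ≤ 3/2 * ‖u‖` for `‖u‖ ≤ 1/2`
keeps its values within `ρ` of `z`. -/
theorem exp_ball (z : ℂ) {ρ : ℝ} (hρ : ρ ≤ 1) :
    HasInverseBranch 1 (ball z ρ) (ball (Complex.exp z) (‖Complex.exp z‖ * ρ / 2)) := by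
  have he : Complex.exp z ≠ 0 := Complex.exp_ne_zero z
  have hn : 0 < ‖Complex.exp z‖ := norm_pos_iff.2 he
  have hu : ∀ w ∈ ball (Complex.exp z) (‖Complex.exp z‖ * ρ / 2),
      ‖w / Complex.exp z - 1‖ < ρ / 2 := by
    intro w hw
    rw [mem_ball, dist_eq_norm] at hw
    rw [div_sub_one he, norm_div, div_lt_iff₀ hn]
    linarith
  refine ⟨fun w => z + Complex.log (1 + (w / Complex.exp z - 1)), ?_, ?_, ?_⟩
  · intro w hw
    refine DifferentiableAt.differentiableWithinAt ?_
    refine DifferentiableAt.const_add _ (DifferentiableAt.clog (by fun_prop) ?_)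
    exact Complex.mem_slitPlane_of_norm_lt_one ((hu w hw).trans (by linarith))
  · intro w hw
    have h1 := hu w hw
    have h2 := Complex.norm_log_one_add_half_le_self (h1.le.trans (by linarith))
    rw [mem_ball, dist_eq_norm, add_sub_cancel_left]
    linarith [norm_nonneg (w / Complex.exp z - 1)]
  · intro w hw
    have h0 : w ≠ 0 := by
      rintro rfl
      have := hu 0 hw
      simp at this
      linarith
    simp only [iterate_one]
    rw [Complex.exp_add, add_sub_cancel, Complex.exp_log (div_ne_zero h0 he)]
    field_simp

theorem exists_ball_iterate {U : Set ℂ} (hU : IsOpen U) {z : ℂ} (hz : z ∈ U) (n : ℕ) :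
    ∃ ρ > 0, HasInverseBranch n U (ball (Complex.exp^[n] z) ρ) := by
  induction n with
  | zero =>
    obtain ⟨r, hr, hrU⟩ := Metric.isOpen_iff.1 hU z hz
    exact ⟨r, hr, (refl U).mono Subset.rfl hrU⟩
  | succ n ih =>
    obtain ⟨ρ, hρ, h⟩ := ih
    rw [iterate_succ_apply', add_comm n 1]
    exact ⟨_, by have := norm_pos_iff.2 (Complex.exp_ne_zero (Complex.exp^[n] z)); positivity,
      h.trans (exp_ball _ (min_le_right ρ 1)) (ball_subset_ball (min_le_left ρ 1))⟩

theorem exists_large_real {U : Set ℂ} (hU : IsOpen U) (hne : U.Nonempty) (T : ℝ) :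
    ∃ n : ℕ, ∃ x ≥ T, ∃ ρ > 0, HasInverseBranch n U (ball (x : ℂ) ρ) := by
  obtain ⟨z, hz, n, hn⟩ := exists_iterate_exp_im_eq_zero hU hne
  have key : ∀ k : ℕ, ∃ x : ℝ, (Complex.exp^[n] z).re + k ≤ x ∧ Complex.exp^[k + n] z = x := by
    intro k
    induction k with
    | zero => exact ⟨(Complex.exp^[n] z).re, by simp, by apply Complex.ext <;> simp [hn]⟩
    | succ k ih =>
      obtain ⟨x, hx, he⟩ := ih
      refine ⟨Real.exp x, ?_, ?_⟩
      · push_cast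
        linarith [Real.add_one_le_exp x]
      · rw [show k + 1 + n = (k + n) + 1 by ring, iterate_succ_apply', he, Complex.ofReal_exp]
  obtain ⟨k, hk⟩ := exists_nat_ge (T - (Complex.exp^[n] z).re)
  obtain ⟨x, hx, he⟩ := key k
  obtain ⟨ρ, hρ, h⟩ := exists_ball_iterate hU hz (k + n)
  exact ⟨k + n, x, by linarith, ρ, hρ, he ▸ h⟩

/-! ### Growth of discs along real orbits -/

theorem exp_ball_ofReal (x : ℝ) {ρ : ℝ} (hρ : ρ ≤ 1) :
    HasInverseBranch 1 (ball (x : ℂ) ρ) (ball ((Real.exp x : ℝ) : ℂ) (Real.exp x * ρ / 2)) := by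
  have := exp_ball (x : ℂ) hρ
  rwa [Complex.norm_exp, Complex.ofReal_re, ← Complex.ofReal_exp] at this

/-- Discs around large real points grow under iteration until their radii are comparable with the
moduli of their centres. -/
theorem exists_large_ball {U : Set ℂ} (hU : IsOpen U) (hne : U.Nonempty) (T : ℝ) :
    ∃ n : ℕ, ∃ x ≥ T, HasInverseBranch n U (ball (x : ℂ) (x / 2)) := by
  -- Beyond 4, `exp x / 2 ≥ 2`, so each step at least doubles the radius until it is capped at 1.
  obtain ⟨n, x₀, hx₀, ρ, hρ, h₀⟩ := exists_large_real hU hne (max T 4)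
  have key : ∀ k : ℕ, ∃ m : ℕ, ∃ x ≥ max T 4,
      HasInverseBranch m U (ball (x : ℂ) (min (2 ^ k * ρ) 1)) := by
    intro k
    induction k with
    | zero => exact ⟨n, x₀, hx₀, h₀.mono Subset.rfl (ball_subset_ball (by simp))⟩
    | succ k ih =>
      obtain ⟨m, x, hx, h⟩ := ih
      have hxe := Real.add_one_le_exp x
      have hx4 : 4 ≤ x := (le_max_right T 4).trans hx
      refine ⟨1 + m, Real.exp x, hx.trans (by linarith), ?_⟩
      refine (h.trans (exp_ball_ofReal x (min_le_right _ _)) Subset.rfl).mono Subset.rfl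
        (ball_subset_ball ?_)
      have hpos : 0 < min (2 ^ k * ρ) 1 := lt_min (by positivity) one_pos
      have h1 : 2 * min (2 ^ k * ρ) 1 ≤ Real.exp x * min (2 ^ k * ρ) 1 / 2 := by nlinarith
      refine le_trans ?_ h1
      rw [pow_succ, mul_min_of_nonneg _ _ (by norm_num : (0 : ℝ) ≤ 2)]
      exact min_le_min (by linarith) (by norm_num)
  obtain ⟨k, hk⟩ := pow_unbounded_of_one_lt (1 / ρ) (one_lt_two : (1 : ℝ) < 2)
  obtain ⟨m, x, hx, h⟩ := key k
  rw [div_lt_iff₀ hρ] at hk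
  rw [min_eq_right hk.le] at h
  have hxe := Real.add_one_le_exp x
  refine ⟨1 + m, Real.exp x, by linarith [(le_max_left T 4).trans hx], ?_⟩
  simpa using h.trans (exp_ball_ofReal x le_rfl) Subset.rfl

/-- Every point `v ≠ 0` has a second preimage under the exponential map near a prescribed large
real number, with intermediate point of large modulus. -/
theorem exists_exp_exp_eq {v : ℂ} (hv : v ≠ 0) :
    ∃ T : ℝ, ∀ x ≥ T, ∃ u : ℂ, ‖u - x‖ ≤ 7 ∧ 2 ≤ ‖Complex.exp u‖ ∧
      Complex.exp (Complex.exp u) = v := by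
  refine ⟨max 2 ‖Complex.log v‖, fun x hx => ?_⟩
  have hx2 : 2 ≤ x := (le_max_left _ _).trans hx
  have hxv : ‖Complex.log v‖ ≤ x := (le_max_right _ _).trans hx
  have hxe := Real.add_one_le_exp x
  -- Shifting the logarithm of `v` by about `exp x` periods gives it modulus between `exp x` and
  -- `exp (x + 3)`; its own logarithm then lies within `3 + 4` of `x`.
  set k : ℕ := ⌈Real.exp x⌉₊ with hk
  have hk1 : Real.exp x ≤ k := Nat.le_ceil _
  have hk2 : (k : ℝ) < Real.exp x + 1 := Nat.ceil_lt_add_one (Real.exp_pos x).le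
  set w : ℂ := Complex.log v + k * (2 * Real.pi * Complex.I) with hw
  have hkn : ‖(k : ℂ) * (2 * Real.pi * Complex.I)‖ = 2 * Real.pi * k := by
    simp [abs_of_pos Real.pi_pos]
    ring
  have hpi3 := Real.pi_gt_three
  have hpi4 := Real.pi_le_four
  have hwge : Real.exp x ≤ ‖w‖ := by
    have h1 : ‖(k : ℂ) * (2 * Real.pi * Complex.I)‖ ≤ ‖w‖ + ‖Complex.log v‖ := by
      have : (k : ℂ) * (2 * Real.pi * Complex.I) = w - Complex.log v := by rw [hw]; ring
      rw [this]
      exact norm_sub_le _ _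
    rw [hkn] at h1
    nlinarith
  have hwle : ‖w‖ ≤ Real.exp (x + 3) := by
    have h1 : ‖w‖ ≤ ‖Complex.log v‖ + 2 * Real.pi * k := hkn ▸ norm_add_le _ _
    have h3 : (16 : ℝ) ≤ Real.exp 3 := by
      have h4 : Real.exp 3 = Real.exp 1 ^ 3 := by
        rw [← Real.exp_nat_mul]; norm_num
      have h5 := Real.exp_one_gt_d9
      have h6 : (2.7 : ℝ) ^ 3 ≤ Real.exp 1 ^ 3 := by gcongr; linarith
      rw [h4]
      norm_num at h6 ⊢
      linarith
    rw [Real.exp_add]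
    nlinarith [Real.pi_lt_d2]
  have hwpos : 0 < ‖w‖ := (Real.exp_pos x).trans_le hwge
  have hw0 : w ≠ 0 := norm_pos_iff.1 hwpos
  refine ⟨Complex.log w, ?_, ?_, ?_⟩
  · have hre : |(Complex.log w - x).re| ≤ 3 := by
      rw [Complex.sub_re, Complex.log_re, Complex.ofReal_re, abs_le]
      have h1 := (Real.le_log_iff_exp_le hwpos).2 hwge
      have h2 := (Real.log_le_iff_le_exp hwpos).2 hwle
      constructor <;> linarith
    have him : |(Complex.log w - x).im| ≤ 4 := by
      rw [Complex.sub_im, Complex.log_im, Complex.ofReal_im, sub_zero]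
      exact (Complex.abs_arg_le_pi w).trans hpi4
    linarith [Complex.norm_le_abs_re_add_abs_im (Complex.log w - x)]
  · rw [Complex.exp_log hw0]
    linarith
  · rw [Complex.exp_log hw0, hw, Complex.exp_periodic.nat_mul k, Complex.exp_log hv]

/-- Every nonempty open set contains the image of the disc of radius `‖v‖ / 2` around `v ≠ 0` under
an inverse branch of a positive iterate of the exponential map. -/
theorem exists_ball_half_norm {U : Set ℂ} (hU : IsOpen U) (hne : U.Nonempty) {v : ℂ}
    (hv : v ≠ 0) : ∃ n > 0, HasInverseBranch n U (ball v (‖v‖ / 2)) := by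
  obtain ⟨T, hT⟩ := exists_exp_exp_eq hv
  -- With `x ≥ 20`, the unit disc about `u` fits: `7 + 1 ≤ x / 2`.
  obtain ⟨n, x, hx, h⟩ := exists_large_ball hU hne (max T 20)
  obtain ⟨u, hux, hu2, hu⟩ := hT x ((le_max_left _ _).trans hx)
  have hx20 : 20 ≤ x := (le_max_right _ _).trans hx
  have h1 := h.trans (exp_ball u le_rfl) (ball_subset_ball' (by rw [dist_eq_norm]; linarith))
  have h2 := h1.trans (exp_ball (Complex.exp u) le_rfl) (ball_subset_ball (by linarith))
  rw [hu, mul_one] at h2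
  exact ⟨_, by omega, h2⟩

/-- An inverse branch that maps a disc into a much smaller concentric disc has a fixed point. -/
theorem exists_isPeriodicPt {n : ℕ} {v : ℂ} {R s : ℝ} (hs : 0 < s) (hsR : 8 * s ≤ R)
    (h : HasInverseBranch n (ball v s) (ball v R)) :
    ∃ p ∈ ball v s, IsPeriodicPt Complex.exp n p := by
  obtain ⟨g, hd, hm, he⟩ := h
  have hsub : closedBall v s ⊆ ball v R := closedBall_subset_ball (by linarith)
  have hmaps : MapsTo g (closedBall v s) (closedBall v s) := fun x hx =>
    ball_subset_closedBall (hm (hsub hx))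
  -- Schwarz on discs of radius `R / 2` gives the Lipschitz constant `2 * s / (R / 2) ≤ 1 / 2`.
  have hlip : ContractingWith (1 / 2) (hmaps.restrict g _ _) := by
    refine ⟨by rw [← NNReal.coe_lt_coe]; norm_num, LipschitzWith.of_dist_le_mul ?_⟩
    rintro ⟨z, hz⟩ ⟨x, hx⟩
    have hxR : ball x (R / 2) ⊆ ball v R :=
      ball_subset_ball' (by linarith [mem_closedBall.1 hx])
    have hzx : z ∈ ball x (R / 2) := by
      rw [mem_ball]
      linarith [dist_triangle_right z x v, mem_closedBall.1 hx, mem_closedBall.1 hz]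
    have hmx : MapsTo g (ball x (R / 2)) (closedBall (g x) (2 * s)) := by
      intro t ht
      have h1 := mem_ball.1 (hm (hxR ht))
      have h2 := mem_ball.1 (hm (hsub hx))
      rw [mem_closedBall]
      linarith [dist_triangle_right (g t) (g x) v]
    have h3 := Complex.dist_le_div_mul_dist_of_mapsTo_ball (hd.mono hxR) hmx hzx
    have h4 : 2 * s / (R / 2) ≤ 1 / 2 := by
      rw [div_le_iff₀ (by linarith)]
      linarith
    have h5 : dist (g z) (g x) ≤ 1 / 2 * dist z x :=
      h3.trans (mul_le_mul_of_nonneg_right h4 dist_nonneg)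
    simpa [Subtype.dist_eq] using h5
  obtain ⟨p, hp, hfix, -⟩ := hlip.exists_fixedPoint' isClosed_closedBall.isComplete hmaps
    (mem_closedBall_self hs.le) (edist_ne_top _ _)
  have hpR := hsub hp
  refine ⟨p, hfix.eq ▸ hm hpR, ?_⟩
  have h6 := he p hpR
  rwa [hfix.eq] at h6

end HasInverseBranch

/-! ### Periodic points and transitivity -/

theorem exists_mem_ne_zero_of_isOpen {U : Set ℂ} (hU : IsOpen U) (hne : U.Nonempty) :
    ∃ v ∈ U, v ≠ 0 :=
  (dense_compl_singleton (0 : ℂ)).inter_open_nonempty U hU hne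

theorem dense_periodicPts_exp : Dense (periodicPts Complex.exp) := by
  refine dense_iff_inter_open.2 fun U hU hne => ?_
  obtain ⟨v, hvU, hv⟩ := exists_mem_ne_zero_of_isOpen hU hne
  obtain ⟨r, hr, hrU⟩ := Metric.isOpen_iff.1 hU v hvU
  have hvn : 0 < ‖v‖ := norm_pos_iff.2 hv
  -- The 16 provides `8 * s ≤ ‖v‖ / 2`.
  have hs : 0 < min r (‖v‖ / 16) := lt_min hr (by positivity)
  obtain ⟨n, hn, h⟩ := HasInverseBranch.exists_ball_half_norm isOpen_ball
    (nonempty_ball.2 hs) hv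
  obtain ⟨p, hp, hper⟩ := h.exists_isPeriodicPt hs
    (by linarith [min_le_right r (‖v‖ / 16)])
  exact ⟨p, hrU (ball_subset_ball (min_le_left _ _) hp), mk_mem_periodicPts hn hper⟩

theorem isTopTransitive_exp : IsTopTransitive Complex.exp := by
  intro U V hU hV hUne hVne
  obtain ⟨v, hvV, hv⟩ := exists_mem_ne_zero_of_isOpen hV hVne
  obtain ⟨n, -, g, -, hm, he⟩ := HasInverseBranch.exists_ball_half_norm hU hUne hv
  have hmem : v ∈ ball v (‖v‖ / 2) := mem_ball_self (half_pos (norm_pos_iff.2 hv))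
  exact ⟨g v, hm hmem, n, (he v hmem).symm ▸ hvV⟩

theorem theorem1p2 : IsDevaneyChaotic (fun z : ℂ => Complex.exp z) :=
  ⟨inferInstance, Complex.continuous_exp, dense_periodicPts_exp, isTopTransitive_exp⟩
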